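/- Let $k$ be a field of characteristic zero and $t\ge 1$ an integer. For a field $K$ of characteristic zero let $G(K)\subseteq GL_t(K)$ be one of the groups $GL_t(K)$, $SL_t(K)$, $O_t(K)=\{M: M^{\mathrm{tr}}M=I\}$ or, for $t$ even, $Sp_t(K)=\{M: M^{\mathrm{tr}}\Omega M=\Omega\}$ with $\Omega=\begin{pmatrix}0&I\\-I&0\end{pmatrix}$ (the same family for all $K$). Let $K[Z]$ be one of the polynomial rings $K[Y]$ or $K[X,Y]$, where $X=(x_{ij})$ and $Y=(y_{ij})$ are matrices of independent indeterminates of sizes $m\times t$ and $t\times n$ (any $m,n\ge 0$), and let $M\in G(K)$ act on $K[Z]$ by the $K$-algebra automorphism given by $Y\mapsto MY$ in the first case, and by $X\mapsto XM^{-1}$, $Y\mapsto MY$ in the second. Write $K[Z]^{G(K)}$ for the ring of invariants. A Reynolds operator over $K$ is a $K$-linear map $\mathcal R_K\colon K[Z]\to K[Z]^{G(K)}$ with $\mathcal R_K(f)=f$ for all invariants $f$ and $\mathcal R_K(M(f))=\mathcal R_K(f)$ for all $M\in G(K)$ and $f\in K[Z]$. Then there is exactly one Reynolds operator over each of $k$,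 $\mathbb Q$ and $\mathbb C$; the inclusion $\mathbb Q[Z]\subseteq k[Z]$ maps $\mathbb Q[Z]^{G(\mathbb Q)}$ into $k[Z]^{G(k)}$; and $$\mathcal R_k(f)=\mathcal R_{\mathbb Q}(f)\qquad\text{for all } f\in\mathbb Q[Z],$$ an equality in $k[Z]$. In particular, for every monomial $\mu$ in the indeterminates $Z$ one has $\mathcal R_k(\mu)=\mathcal R_{\mathbb C}(\mu)$, in the sense that both are the image of one and the same polynomial with rational coefficients. -/

import Mathlib

open MvPolynomial Matrix

/-- The four families of classical groups. -/
inductive ClassicalFamily where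
  | GL
  | SL
  | O
  | Sp

/-- The group of invertible matrices `M` with `Mᵀ B M = B`. -/
def isometryGroup {t : ℕ} {k : Type*} [Field k] (B : Matrix (Fin t) (Fin t) k) :
    Subgroup (GL (Fin t) k) where
  carrier := {M | (M : Matrix (Fin t) (Fin t) k)ᵀ * B * (M : Matrix (Fin t) (Fin t) k) = B}
  one_mem' := by simp
  mul_mem' := by
    intro M N hM hN
    simp only [Set.mem_ofPred_eq, Units.val_mul, Matrix.transpose_mul] at *
    calc (N : Matrix (Fin t) (Fin t) k)ᵀ * (M : Matrix (Fin t) (Fin t) k)ᵀ * B *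
          ((M : Matrix (Fin t) (Fin t) k) * (N : Matrix (Fin t) (Fin t) k))
        = (N : Matrix (Fin t) (Fin t) k)ᵀ *
          ((M : Matrix (Fin t) (Fin t) k)ᵀ * B * (M : Matrix (Fin t) (Fin t) k)) *
          (N : Matrix (Fin t) (Fin t) k) := by simp only [Matrix.mul_assoc]
      _ = B := by rw [hM, hN]
  inv_mem' := by
    intro M hM
    simp only [Set.mem_ofPred_eq] at *
    have h1 : (M : Matrix (Fin t) (Fin t) k) * ((M⁻¹ : GL (Fin t) k) : Matrix (Fin t) (Fin t) k)
        = 1 := M.mul_inv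
    have h2 : ((M⁻¹ : GL (Fin t) k) : Matrix (Fin t) (Fin t) k)ᵀ *
        (M : Matrix (Fin t) (Fin t) k)ᵀ = 1 := by
      rw [← Matrix.transpose_mul, h1, Matrix.transpose_one]
    calc ((M⁻¹ : GL (Fin t) k) : Matrix (Fin t) (Fin t) k)ᵀ * B *
          ((M⁻¹ : GL (Fin t) k) : Matrix (Fin t) (Fin t) k)
        = ((M⁻¹ : GL (Fin t) k) : Matrix (Fin t) (Fin t) k)ᵀ *
          ((M : Matrix (Fin t) (Fin t) k)ᵀ * B * (M : Matrix (Fin t) (Fin t) k)) *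
          ((M⁻¹ : GL (Fin t) k) : Matrix (Fin t) (Fin t) k) := by rw [hM]
      _ = (((M⁻¹ : GL (Fin t) k) : Matrix (Fin t) (Fin t) k)ᵀ *
          (M : Matrix (Fin t) (Fin t) k)ᵀ) * B * ((M : Matrix (Fin t) (Fin t) k) *
          ((M⁻¹ : GL (Fin t) k) : Matrix (Fin t) (Fin t) k)) := by
            simp only [Matrix.mul_assoc]
      _ = B := by rw [h1, h2, Matrix.one_mul, Matrix.mul_one]

/-- For even `t`, the block matrix `[[0, I], [-I, 0]]` of size `t`. -/
def symplecticForm (t : ℕ) (k : Type*) [Field k] : Matrix (Fin t) (Fin t) k :=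
  Matrix.of fun i j =>
    if (i : ℕ) + t / 2 = j then 1 else if (j : ℕ) + t / 2 = i then -1 else 0

/-- The classical group `G(k)` of `t × t` matrices; in the symplectic case it is meant
for even `t` only. -/
def ClassicalFamily.group (G : ClassicalFamily) (t : ℕ) (k : Type*) [Field k] :
    Subgroup (GL (Fin t) k) :=
  match G with
  | .GL => ⊤
  | .SL => (Matrix.GeneralLinearGroup.det : GL (Fin t) k →* kˣ).ker
  | .O => isometryGroup 1
  | .Sp => isometryGroup (symplecticForm t k)

/-- The two types of classical actions: on `k[Y]` with `Y` of size `t × n`, and on `k[X, Y]`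
with `X` of size `m × t` and `Y` of size `t × n`. -/
inductive ClassicalAction where
  | standard (n : ℕ)
  | standardDual (m n : ℕ)

/-- The set `Z` of indeterminates: the entries `y i j` of the `t × n` matrix `Y` in the first
case, the entries `x i j` of the `m × t` matrix `X` and `y' i j` of the `t × n` matrix `Y` in the
second. -/
inductive ClassicalAction.Vars (t : ℕ) : ClassicalAction → Type
  | y {n : ℕ} (i : Fin t) (j : Fin n) : Vars t (.standard n)
  | x {m n : ℕ} (i : Fin m) (j : Fin t) : Vars t (.standardDual m n)
  | y' {m n : ℕ} (i : Fin t) (j : Fin n) : Vars t (.standardDual m n)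

noncomputable section

/-- The images of the indeterminates under `M`: `Y ↦ M Y`, respectively
`X ↦ X M⁻¹` and `Y ↦ M Y`, written out entry by entry. -/
def ClassicalAction.subst {t : ℕ} {k : Type*} [Field k] {A : ClassicalAction}
    (M : GL (Fin t) k) : ClassicalAction.Vars t A → MvPolynomial (ClassicalAction.Vars t A) k
  | .y i j => ∑ l : Fin t, C (M.val i l) * X (.y l j)
  | .x i j => ∑ l : Fin t, X (.x i l) * C ((M⁻¹).val l j)
  | .y' i j => ∑ l : Fin t, C (M.val i l) * X (.y' l j)

/-- The `k`-algebra endomorphism of `k[Z]` by which an invertible matrix `M` acts. -/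
def ClassicalAction.act {t : ℕ} {k : Type*} [Field k] (A : ClassicalAction)
    (M : GL (Fin t) k) : MvPolynomial (ClassicalAction.Vars t A) k →ₐ[k] MvPolynomial (ClassicalAction.Vars t A) k :=
  MvPolynomial.aeval (ClassicalAction.subst M)

/-- The ring of invariants `k[Z]^{G(k)}`. -/
def invariants (G : ClassicalFamily) (A : ClassicalAction) (t : ℕ) (k : Type*) [Field k] :
    Subalgebra k (MvPolynomial (ClassicalAction.Vars t A) k) where
  carrier := {f | ∀ M ∈ G.group t k, A.act M f = f}
  mul_mem' := by
    intro a b ha hb M hM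
    rw [map_mul, ha M hM, hb M hM]
  add_mem' := by
    intro a b ha hb M hM
    rw [map_add, ha M hM, hb M hM]
  algebraMap_mem' := by
    intro r M _
    exact AlgHom.commutes _ r

/-- `R : k[Z] → k[Z]^{G(k)}` is a Reynolds operator: a `k`-linear splitting of the inclusion
`k[Z]^{G(k)} ⊆ k[Z]` that is `G(k)`-equivariant. -/
structure IsReynolds {G : ClassicalFamily} {A : ClassicalAction} {t : ℕ} {k : Type*} [Field k]
    (R : MvPolynomial (ClassicalAction.Vars t A) k →ₗ[k] invariants G A t k) : Prop where
  apply_invariant : ∀ f : invariants G A t k, R (f : MvPolynomial (ClassicalAction.Vars t A) k) = f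
  apply_act : ∀ M ∈ G.group t k, ∀ f : MvPolynomial (ClassicalAction.Vars t A) k, R (A.act M f) = R f

/-- The inclusion `ℚ[Z] ⊆ k[Z]`. -/
def ratIncl (σ : Type*) (k : Type*) [Field k] [CharZero k] :
    MvPolynomial σ ℚ →+* MvPolynomial σ k :=
  MvPolynomial.map (Rat.castHom k)

end

/-! Write `D` for the span of all differences `M f - f` with `M` in the group. A Reynolds operator
kills `D` and fixes the invariants, so everything follows from `K[Z] = K[Z]^G ⊕ D`, provided that
the decomposition over `ℚ` maps into the one over `k`.

Over `ℚ` the Fischer form is positive definite, and the adjoint of the action of `M` is the action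
of `Mᵀ` (`fischerForm_act`). Each of the groups is closed under transposition, so in every degree
the orthogonal complement of the differences consists of invariants.

Over `k` positivity is lost, but the rational decomposition of each monomial survives base change.
Differences clearly go to differences. Rational invariants stay invariant (`ratIncl_mem_invariants`)
because `G(ℚ)` is dense in `G(k)`: the groups are covered by rational families of matrices, namely
the generic matrix for `GL`, the generic matrix with one row divided by its determinant for `SL`,
and Cayley transforms translated by integral isometries for `O` and `Sp`. The sum is direct because
the Fischer form is nondegenerate in characteristic zero and makes invariants orthogonal to `D`. -/

noncomputable section

/-! ### The Fischer form and its adjoints. -/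

section Fischer

variable {σ : Type*} {K : Type*} [Field K]

/-- The Fischer (apolar) bilinear form on polynomials: monomials are orthogonal, and the monomial
with exponent `d` has square `d!`. -/
def fischerForm (σ K : Type*) [Field K] :
    MvPolynomial σ K →ₗ[K] MvPolynomial σ K →ₗ[K] K :=
  (basisMonomials σ K).constr K fun d => ((d.prod fun _ n => n.factorial : ℕ) : K) • lcoeff K d

lemma fischerForm_monomial (d : σ →₀ ℕ) (a : K) (g : MvPolynomial σ K) :
    fischerForm σ K (monomial d a) g = a * ((d.prod fun _ n => n.factorial : ℕ) * coeff d g) := by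
  have h : monomial d a = a • basisMonomials σ K d := by
    simp [smul_monomial]
  rw [h, fischerForm, map_smul, Module.Basis.constr_basis]
  simp

lemma fischerForm_comm (f g : MvPolynomial σ K) :
    fischerForm σ K f g = fischerForm σ K g f := by
  have : fischerForm σ K = (fischerForm σ K).flip := by
    refine (basisMonomials σ K).ext fun d => (basisMonomials σ K).ext fun e => ?_
    classical
    simp only [coe_basisMonomials, LinearMap.flip_apply, fischerForm_monomial, coeff_monomial]
    by_cases h : d = e
    · subst h; rfl
    · simp [h, Ne.symm h]
  exact LinearMap.congr_fun₂ this f g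

lemma eq_zero_of_fischerForm_eq_zero [CharZero K] {f : MvPolynomial σ K}
    (h : ∀ g, fischerForm σ K g f = 0) : f = 0 := by
  ext d
  have := h (monomial d 1)
  rw [fischerForm_monomial, one_mul, mul_eq_zero] at this
  refine this.resolve_left ?_
  exact_mod_cast (Finset.prod_pos fun i _ => Nat.factorial_pos _).ne'

/-- The value at `(f, f)` is a sum of squares of coefficients with positive weights `d!`. This is
where an ordered field such as `ℚ` is needed. -/
lemma eq_zero_of_fischerForm_self_eq_zero [LinearOrder K] [IsStrictOrderedRing K]
    {f : MvPolynomial σ K} (h : fischerForm σ K f f = 0) : f = 0 := by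
  have hs : fischerForm σ K f f = ∑ d ∈ f.support,
      coeff d f * ((d.prod fun _ n => n.factorial : ℕ) * coeff d f) := by
    conv_lhs => enter [1]; rw [f.as_sum]
    simp only [map_sum, LinearMap.sum_apply, fischerForm_monomial]
  have hpos (d : σ →₀ ℕ) : (0 : K) < (d.prod fun _ n => n.factorial : ℕ) := by
    exact_mod_cast Finset.prod_pos fun i _ => Nat.factorial_pos _
  rw [hs, Finset.sum_eq_zero_iff_of_nonneg] at h
  · ext d
    by_cases hd : d ∈ f.support
    · have := h d hd
      exact (mul_eq_zero.1 this).elim id fun h => (mul_eq_zero.1 h).resolve_left (hpos d).ne'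
    · simpa using hd
  · intro d _
    nlinarith [mul_nonneg (hpos d).le (mul_self_nonneg (coeff d f))]

/-- The weights `d!` are chosen for this: raising the exponent of `i` by one multiplies the weight
by `d i + 1`, the factor produced by differentiation. -/
lemma fischerForm_X_mul (i : σ) (f g : MvPolynomial σ K) :
    fischerForm σ K (X i * f) g = fischerForm σ K f (pderiv i g) := by
  classical
  induction f using MvPolynomial.induction_on' with
  | add p q hp hq => simp only [mul_add, map_add, LinearMap.add_apply, hp, hq]
  | monomial d a =>
    have hf : ((d + Finsupp.single i 1).prod fun _ n => n.factorial)
        = (d.prod fun _ n => n.factorial) * (d i + 1) := by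
      rw [← Finsupp.mul_prod_erase' (d + Finsupp.single i 1) i _ (fun _ => rfl),
        ← Finsupp.mul_prod_erase' d i _ (fun _ => rfl)]
      have : (d + Finsupp.single i 1).erase i = d.erase i := by
        rw [Finsupp.erase_add]; simp
      rw [this]
      simp only [Finsupp.coe_add, Pi.add_apply, Finsupp.single_eq_same, Nat.factorial_succ]
      ring
    rw [X, monomial_mul, one_mul, add_comm, fischerForm_monomial, fischerForm_monomial,
      coeff_pderiv, hf]
    push_cast
    ring

/-- Linear substitutions with transposed coefficients are adjoint for the Fischer form. -/
lemma fischerForm_aeval [Fintype σ] (a : σ → σ → K) (f g : MvPolynomial σ K) :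
    fischerForm σ K (aeval (fun i => ∑ j, C (a i j) * X j) f) g =
      fischerForm σ K f (aeval (fun j => ∑ i, C (a i j) * X i) g) := by
  classical
  -- Chain rule for a linear substitution.
  have hchain (i : σ) (g : MvPolynomial σ K) :
      pderiv i (aeval (fun j => ∑ i, C (a i j) * X i) g : MvPolynomial σ K) =
        ∑ j, C (a i j) * aeval (fun j => ∑ i, C (a i j) * X i) (pderiv j g) := by
    induction g using MvPolynomial.induction_on with
    | C r => simp
    | add p q hp hq => simp only [map_add, hp, hq, mul_add, Finset.sum_add_distrib]
    | mul_X p v hp =>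
      simp only [map_mul, aeval_X, Derivation.leibniz, smul_eq_mul, hp, map_sum, pderiv_X,
        pderiv_C, map_add, mul_add, Finset.sum_add_distrib]
      congr 1
      · simp [Pi.single_apply, mul_comm]
      · rw [Finset.mul_sum]
        exact Finset.sum_congr rfl fun j _ => by ring
  induction f using MvPolynomial.induction_on generalizing g with
  | C r =>
    have h0 : coeff 0 (aeval (fun j => ∑ i, C (a i j) * X i) g : MvPolynomial σ K) =
        coeff 0 g := by
      induction g using MvPolynomial.induction_on with
      | C r => simp
      | add p q hp hq => simp only [map_add, coeff_add, hp, hq]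
      | mul_X p v hp =>
        simp only [← constantCoeff_eq, map_mul, aeval_X, map_sum, constantCoeff_X] at hp ⊢
        simp
    rw [aeval_C, algebraMap_eq, C_apply, fischerForm_monomial, fischerForm_monomial, h0]
  | add p q hp hq => simp only [map_add, LinearMap.add_apply, hp, hq]
  | mul_X p v hp =>
    -- Each variable of the substituted linear form moves across as a derivative. The chain rule
    -- turns these into derivatives of `g` before substitution, to which the induction hypothesis
    -- applies.
    rw [map_mul, aeval_X, Finset.mul_sum, map_sum, LinearMap.sum_apply, mul_comm p,
      fischerForm_X_mul, hchain, map_sum]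
    refine Finset.sum_congr rfl fun j _ => ?_
    rw [← smul_eq_C_mul, ← smul_eq_C_mul, mul_smul_comm, map_smul, map_smul,
      LinearMap.smul_apply, mul_comm, fischerForm_X_mul, hp]

end Fischer

/-! ### Orthogonal splitting for an anisotropic form. -/

section Splitting

variable {K V ι : Type*} [Field K] [AddCommGroup V] [Module K V]

/-- For an anisotropic symmetric form and a family of operators `T` with adjoints `T'`, every
vector of a finite-dimensional stable subspace is the sum of a vector fixed by all `T' i` and a
combination of the vectors `T i v - v`. -/
lemma mem_fixed_sup_span_of_anisotropic (B : V →ₗ[K] V →ₗ[K] K) (hB : ∀ x y, B x y = B y x)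
    (hB0 : ∀ x, B x x = 0 → x = 0) (T T' : ι → V →ₗ[K] V)
    (hT : ∀ i x y, B (T i x) y = B x (T' i y)) (E : Submodule K V) [FiniteDimensional K E]
    (hE : ∀ i, ∀ x ∈ E, T i x ∈ E) (hE' : ∀ i, ∀ x ∈ E, T' i x ∈ E) {f : V} (hf : f ∈ E) :
    ∃ u, (∀ i, T' i u = u) ∧ ∃ w ∈ Submodule.span K {v | ∃ i x, v = T i x - x}, f = u + w := by
  let b : LinearMap.BilinForm K E := B.domRestrict₁₂ E E
  let W : Submodule K E := Submodule.span K {v | ∃ i, ∃ x : E, (v : V) = T i x - x}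
  have hd : Disjoint W (b.orthogonal W) := by
    rw [Submodule.disjoint_def]
    intro x hx hx'
    exact Subtype.ext (hB0 x (hx' x hx))
  have hc := (LinearMap.BilinForm.isCompl_orthogonal_iff_disjoint
    (fun x y h => by rw [← h]; exact hB _ _) (B := b) (W := W)).2 hd
  obtain ⟨w, hw, u, hu, hwu⟩ := Submodule.mem_sup.1
    (hc.sup_eq_top ▸ Submodule.mem_top : (⟨f, hf⟩ : E) ∈ W ⊔ b.orthogonal W)
  refine ⟨u, fun i => ?_, w, ?_, ?_⟩
  -- By adjointness `B y (T' i u - u) = B (T i y - y) u = 0`; anisotropy is then used at `y = T' i u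
  -- - u`.
  · have key : ∀ y ∈ E, B y (T' i u - u) = 0 := by
      intro y hy
      have h1 : b ⟨T i y - y, E.sub_mem (hE i y hy) hy⟩ u = 0 :=
        hu _ (Submodule.subset_span ⟨i, ⟨y, hy⟩, rfl⟩)
      have h2 : B (T i y - y) u = 0 := h1
      rw [map_sub, LinearMap.sub_apply, hT] at h2
      rw [map_sub, h2]
    exact sub_eq_zero.1 (hB0 _ (key _ (E.sub_mem (hE' i u u.2) u.2)))
  · have : W.map E.subtype ≤ Submodule.span K {v | ∃ i x, v = T i x - x} := by
      rw [Submodule.map_span_le]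
      rintro x ⟨i, y, hy⟩
      exact Submodule.subset_span ⟨i, y, hy⟩
    exact this ⟨w, hw, rfl⟩
  · rw [add_comm]; exact (congrArg Subtype.val hwu).symm

end Splitting

end

noncomputable section

/-! ### Transposition as adjoint of the group action. -/

section Adjoint

variable {t : ℕ} {A : ClassicalAction} {K : Type*} [Field K]

instance : Finite (ClassicalAction.Vars t A) := by
  cases A with
  | standard n =>
    refine Finite.of_injective (β := Fin t × Fin n) (fun | .y i j => (i, j)) ?_
    rintro ⟨i, j⟩ ⟨i', j'⟩ h
    simp_all
  | standardDual m n =>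
    refine Finite.of_injective (β := (Fin m × Fin t) ⊕ (Fin t × Fin n))
      (fun | .x i j => .inl (i, j) | .y' i j => .inr (i, j)) ?_
    rintro (_ | _ | _) (_ | _ | _) h <;> simp_all

/-- The transpose of an invertible matrix, as an invertible matrix. -/
def transposeGL (M : GL (Fin t) K) : GL (Fin t) K where
  val := (M : Matrix (Fin t) (Fin t) K)ᵀ
  inv := ((M⁻¹ : GL (Fin t) K) : Matrix (Fin t) (Fin t) K)ᵀ
  val_inv := by
    rw [← Matrix.transpose_mul, ← Units.val_mul, inv_mul_cancel, Units.val_one,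
      Matrix.transpose_one]
  inv_val := by
    rw [← Matrix.transpose_mul, ← Units.val_mul, mul_inv_cancel, Units.val_one,
      Matrix.transpose_one]

lemma transposeGL_val (M : GL (Fin t) K) :
    (transposeGL M : Matrix (Fin t) (Fin t) K) = (M : Matrix (Fin t) (Fin t) K)ᵀ := rfl

lemma transposeGL_inv_val (M : GL (Fin t) K) :
    (((transposeGL M)⁻¹ : GL (Fin t) K) : Matrix (Fin t) (Fin t) K) =
      ((M⁻¹ : GL (Fin t) K) : Matrix (Fin t) (Fin t) K)ᵀ := rfl

lemma transposeGL_transposeGL (M : GL (Fin t) K) : transposeGL (transposeGL M) = M :=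
  Units.ext (Matrix.transpose_transpose _)

/-- The matrix entries of the action of `M` on the span of the indeterminates. -/
def actCoeff (M : GL (Fin t) K) : ClassicalAction.Vars t A → ClassicalAction.Vars t A → K
  | .y i j, .y l j' => if j = j' then M.val i l else 0
  | .x i j, .x i' l => if i = i' then (M⁻¹).val l j else 0
  | .y' i j, .y' l j' => if j = j' then M.val i l else 0
  | .x _ _, .y' _ _ => 0
  | .y' _ _, .x _ _ => 0

/-- On the `X` variables this uses that inversion commutes with transposition. -/
lemma actCoeff_transposeGL (M : GL (Fin t) K) (u v : ClassicalAction.Vars t A) :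
    actCoeff (transposeGL M) u v = actCoeff M v u := by
  cases u <;> cases v <;>
    simp [actCoeff, transposeGL_val, transposeGL_inv_val, -coe_units_inv, eq_comm]

lemma subst_eq_sum [Fintype (ClassicalAction.Vars t A)] (M : GL (Fin t) K)
    (u : ClassicalAction.Vars t A) :
    ClassicalAction.subst M u = ∑ v, C (actCoeff M u v) * X v := by
  classical
  cases u with
  | @y n i j =>
    refine Finset.sum_of_injOn (fun l => .y l j) (fun a _ b _ h => by simpa using h)
      (fun _ _ => by simp) ?_ (fun l _ => by simp [actCoeff])
    rintro (_ | _ | _) - hv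
    simp only [actCoeff]
    rw [if_neg, C_0, zero_mul]
    rintro rfl
    simp at hv
  | @x m n i j =>
    refine Finset.sum_of_injOn (fun l => .x i l) (fun a _ b _ h => by simpa using h)
      (fun _ _ => by simp) ?_ (fun l _ => by simp [actCoeff, mul_comm])
    rintro (_ | _ | _) - hv
    · simp only [actCoeff]
      rw [if_neg, C_0, zero_mul]
      rintro rfl
      simp at hv
    · simp [actCoeff]
  | @y' m n i j =>
    refine Finset.sum_of_injOn (fun l => .y' l j) (fun a _ b _ h => by simpa using h)
      (fun _ _ => by simp) ?_ (fun l _ => by simp [actCoeff])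
    rintro (_ | _ | _) - hv
    · simp [actCoeff]
    · simp only [actCoeff]
      rw [if_neg, C_0, zero_mul]
      rintro rfl
      simp at hv

lemma fischerForm_act (M : GL (Fin t) K) (f g : MvPolynomial (ClassicalAction.Vars t A) K) :
    fischerForm _ K (A.act M f) g = fischerForm _ K f (A.act (transposeGL M) g) := by
  have := Fintype.ofFinite (ClassicalAction.Vars t A)
  have h1 : (ClassicalAction.subst M : ClassicalAction.Vars t A → _) =
      fun u => ∑ v, C (actCoeff M u v) * X v := funext (subst_eq_sum M)
  have h2 : (ClassicalAction.subst (transposeGL M) : ClassicalAction.Vars t A → _) =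
      fun u => ∑ v, C (actCoeff M v u) * X v := by
    funext u
    rw [subst_eq_sum]
    simp only [actCoeff_transposeGL]
  rw [ClassicalAction.act, ClassicalAction.act, h1, h2, fischerForm_aeval]

lemma act_mem_homogeneousSubmodule (M : GL (Fin t) K) {d : ℕ}
    {f : MvPolynomial (ClassicalAction.Vars t A) K}
    (hf : f ∈ homogeneousSubmodule (ClassicalAction.Vars t A) K d) :
    A.act M f ∈ homogeneousSubmodule (ClassicalAction.Vars t A) K d := by
  have := Fintype.ofFinite (ClassicalAction.Vars t A)
  rw [mem_homogeneousSubmodule] at hf ⊢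
  have := hf.aeval (ClassicalAction.subst M) (n := 1) fun u => by
    rw [subst_eq_sum]
    exact IsHomogeneous.sum _ _ _ fun v _ => isHomogeneous_C_mul_X _ _
  rwa [one_mul] at this

lemma mem_isometryGroup {B : Matrix (Fin t) (Fin t) K} {M : GL (Fin t) K} :
    M ∈ isometryGroup B ↔
      (M : Matrix (Fin t) (Fin t) K)ᵀ * B * (M : Matrix (Fin t) (Fin t) K) = B := Iff.rfl

/-- Since `B² = e`, the relation `Nᵀ B N = B` exhibits `e⁻¹ B Nᵀ B` as a left inverse of `N`. It is
also a right inverse, and this rearranges to `N B Nᵀ = B`. -/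
lemma transposeGL_mem_isometryGroup {B : Matrix (Fin t) (Fin t) K} {e : K} (he : e ≠ 0)
    (hB : B * B = e • 1) {M : GL (Fin t) K} (hM : M ∈ isometryGroup B) :
    transposeGL M ∈ isometryGroup B := by
  rw [mem_isometryGroup] at hM ⊢
  rw [transposeGL_val, Matrix.transpose_transpose]
  set N : Matrix (Fin t) (Fin t) K := M.val
  have h1 : (e⁻¹ • (B * Nᵀ * B)) * N = 1 := by
    rw [smul_mul_assoc, show B * Nᵀ * B * N = B * (Nᵀ * B * N) by simp only [Matrix.mul_assoc],
      hM, hB, smul_smul, inv_mul_cancel₀ he, one_smul]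
  have h2 : N * B * Nᵀ * B = e • 1 := by
    have := mul_eq_one_comm.1 h1
    rw [mul_smul_comm, inv_smul_eq_iff₀ he] at this
    simpa only [Matrix.mul_assoc] using this
  calc N * B * Nᵀ = e⁻¹ • ((N * B * Nᵀ * B) * B) := by
        rw [Matrix.mul_assoc _ B B, hB, mul_smul_comm, Matrix.mul_one, smul_smul,
          inv_mul_cancel₀ he, one_smul]
    _ = B := by rw [h2, smul_mul_assoc, Matrix.one_mul, smul_smul, inv_mul_cancel₀ he, one_smul]

/-- The standard symplectic form with integral entries. -/
def intSymplecticForm (t : ℕ) : Matrix (Fin t) (Fin t) ℤ :=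
  Matrix.of fun i j =>
    if (i : ℕ) + t / 2 = j then 1 else if (j : ℕ) + t / 2 = i then -1 else 0

lemma map_intSymplecticForm (t : ℕ) (K : Type*) [Field K] :
    (intSymplecticForm t).map (Int.cast : ℤ → K) = symplecticForm t K := by
  ext i j
  simp only [intSymplecticForm, symplecticForm, Matrix.map_apply, Matrix.of_apply]
  split_ifs <;> simp

lemma intSymplecticForm_transpose (t : ℕ) (ht : Even t) :
    (intSymplecticForm t)ᵀ = (-1 : ℤ) • intSymplecticForm t := by
  obtain ⟨s, rfl⟩ := ht
  ext i j
  have hi := i.2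
  have hj := j.2
  simp only [intSymplecticForm, Matrix.transpose_apply, Matrix.of_apply, Matrix.smul_apply]
  split_ifs <;> first | omega | simp

lemma intSymplecticForm_mul_self (t : ℕ) (ht : Even t) :
    intSymplecticForm t * intSymplecticForm t = (-1 : ℤ) • 1 := by
  obtain ⟨s, rfl⟩ := ht
  ext i j
  have hi := i.2
  have hj := j.2
  have hs : (s + s) / 2 = s := by omega
  rw [Matrix.mul_apply]
  simp only [intSymplecticForm, Matrix.of_apply, Matrix.smul_apply, hs, Matrix.one_apply, Fin.ext_iff]
  -- Row `i` has a single nonzero entry, in column `i + s` or `i - s`.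
  by_cases h : (i : ℕ) < s
  · rw [Finset.sum_eq_single ⟨i + s, by omega⟩]
    · simp only
      split_ifs <;> first | omega | simp
    · intro l _ hl
      have : (l : ℕ) ≠ i + s := fun h => hl (Fin.ext h)
      have := l.2
      rw [if_neg (by omega), if_neg (by omega), zero_mul]
    · simp
  · rw [Finset.sum_eq_single ⟨i - s, by omega⟩]
    · simp only
      split_ifs <;> first | omega | simp
    · intro l _ hl
      have : (l : ℕ) ≠ i - s := fun h => hl (Fin.ext h)
      have := l.2
      rw [if_neg (by omega), if_neg (by omega), zero_mul]
    · simp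

lemma symplecticForm_mul_self (t : ℕ) (ht : Even t) :
    symplecticForm t K * symplecticForm t K = (-1 : K) • 1 := by
  have := congrArg (Int.castRingHom K).mapMatrix (intSymplecticForm_mul_self t ht)
  rw [map_mul, map_zsmul, map_one, neg_one_zsmul] at this
  rw [neg_one_smul, ← this, ← map_intSymplecticForm]
  rfl

lemma transposeGL_mem_group {G : ClassicalFamily} (hSp : G = ClassicalFamily.Sp → Even t)
    {M : GL (Fin t) K} (hM : M ∈ G.group t K) : transposeGL M ∈ G.group t K := by
  rcases G with _ | _ | _ | _
  · exact Subgroup.mem_top _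
  ·
    have h : M.val.det = 1 := congrArg Units.val (MonoidHom.mem_ker.1 hM)
    refine MonoidHom.mem_ker.2 (Units.ext ?_)
    change M.valᵀ.det = 1
    rw [Matrix.det_transpose, h]
  · exact transposeGL_mem_isometryGroup one_ne_zero (by simp) hM
  ·
    exact transposeGL_mem_isometryGroup (neg_ne_zero.2 one_ne_zero)
      (symplecticForm_mul_self t (hSp rfl)) hM

end Adjoint

/-! ### Reynolds operators as projections along the differences. -/

section Reynolds

variable {t : ℕ} {K : Type*} [Field K]

/-- The span of all polynomials `M f - f` with `M` in the group. -/
def actionDifferences (G : ClassicalFamily) (A : ClassicalAction) (t : ℕ) (K : Type*) [Field K] :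
    Submodule K (MvPolynomial (ClassicalAction.Vars t A) K) :=
  Submodule.span K {v | ∃ (M : G.group t K) (f : _), v = A.act (M : GL (Fin t) K) f - f}

variable {G : ClassicalFamily} {A : ClassicalAction}

/-- Moving `M` across the form gives `⟨M f - f, u⟩ = ⟨f, Mᵀ u - u⟩`, and `Mᵀ` is again in the group.
-/
lemma fischerForm_eq_zero_of_mem (hSp : G = ClassicalFamily.Sp → Even t)
    {u w : MvPolynomial (ClassicalAction.Vars t A) K} (hu : u ∈ invariants G A t K)
    (hw : w ∈ actionDifferences G A t K) : fischerForm _ K w u = 0 := by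
  induction hw using Submodule.span_induction with
  | mem x hx =>
    obtain ⟨M, f, rfl⟩ := hx
    rw [map_sub, LinearMap.sub_apply, fischerForm_act, hu _ (transposeGL_mem_group hSp M.2),
      sub_self]
  | zero => simp
  | add x y _ _ hx hy => rw [map_add, LinearMap.add_apply, hx, hy, add_zero]
  | smul a x _ hx => rw [map_smul, LinearMap.smul_apply, hx, smul_zero]

lemma IsReynolds.apply_eq_zero
    {R : MvPolynomial (ClassicalAction.Vars t A) K →ₗ[K] invariants G A t K} (hR : IsReynolds R)
    {w : MvPolynomial (ClassicalAction.Vars t A) K} (hw : w ∈ actionDifferences G A t K) :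
    R w = 0 := by
  have : actionDifferences G A t K ≤ LinearMap.ker R := by
    refine Submodule.span_le.2 ?_
    rintro _ ⟨M, f, rfl⟩
    rw [SetLike.mem_coe, LinearMap.mem_ker, map_sub, hR.apply_act M M.2, sub_self]
  exact this hw

lemma IsReynolds.apply_add
    {R : MvPolynomial (ClassicalAction.Vars t A) K →ₗ[K] invariants G A t K} (hR : IsReynolds R)
    {u w : MvPolynomial (ClassicalAction.Vars t A) K} (hu : u ∈ invariants G A t K)
    (hw : w ∈ actionDifferences G A t K) :
    (R (u + w) : MvPolynomial (ClassicalAction.Vars t A) K) = u := by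
  rw [map_add, hR.apply_eq_zero hw, add_zero, hR.apply_invariant ⟨u, hu⟩]

/-- Spanning suffices: an element of both summands is orthogonal to both, hence to everything, hence
zero. The operator is then forced to be the projection. -/
lemma existsUnique_isReynolds [CharZero K] (hSp : G = ClassicalFamily.Sp → Even t)
    (hsup : Subalgebra.toSubmodule (invariants G A t K) ⊔ actionDifferences G A t K = ⊤) :
    ∃! R : MvPolynomial (ClassicalAction.Vars t A) K →ₗ[K] invariants G A t K, IsReynolds R := by
  have hdis : Disjoint (Subalgebra.toSubmodule (invariants G A t K))
      (actionDifferences G A t K) := by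
    rw [Submodule.disjoint_def]
    intro x hx hx'
    refine eq_zero_of_fischerForm_eq_zero fun g => ?_
    obtain ⟨u, hu, w, hw, rfl⟩ := Submodule.mem_sup.1 (hsup ▸ Submodule.mem_top (x := g))
    rw [map_add, LinearMap.add_apply, fischerForm_eq_zero_of_mem hSp hx hw, fischerForm_comm,
      fischerForm_eq_zero_of_mem hSp hu hx', add_zero]
  have hc : IsCompl (Subalgebra.toSubmodule (invariants G A t K)) (actionDifferences G A t K) :=
    ⟨hdis, codisjoint_iff.2 hsup⟩
  refine ⟨Submodule.projectionOnto _ _ hc, ⟨fun f => ?_, fun M hM f => ?_⟩, fun R hR => ?_⟩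
  · exact Submodule.projectionOnto_apply_left hc f
  · rw [← sub_eq_zero, ← map_sub]
    exact Submodule.projectionOnto_apply_of_mem_right hc
      (Submodule.subset_span ⟨⟨M, hM⟩, f, rfl⟩)
  · refine LinearMap.ext fun f => ?_
    obtain ⟨u, hu, w, hw, rfl⟩ := Submodule.mem_sup.1 (hsup ▸ Submodule.mem_top (x := f))
    refine Subtype.ext ((hR.apply_add hu hw).trans ?_)
    rw [map_add, Submodule.projectionOnto_apply_of_mem_right hc hw, add_zero]
    exact congrArg Subtype.val (Submodule.projectionOnto_apply_left hc ⟨u, hu⟩).symm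

lemma invariants_sup_actionDifferences_of_linearOrder [LinearOrder K] [IsStrictOrderedRing K]
    (hSp : G = ClassicalFamily.Sp → Even t) :
    Subalgebra.toSubmodule (invariants G A t K) ⊔ actionDifferences G A t K = ⊤ := by
  rw [eq_top_iff]
  rintro f -
  rw [← sum_homogeneousComponent f]
  refine Submodule.sum_mem _ fun d _ => ?_
  have : FiniteDimensional K (homogeneousSubmodule (ClassicalAction.Vars t A) K d) :=
    Module.Finite.iff_fg.2 (homogeneousSubmodule_fg _ _ d)
  obtain ⟨u, hu, w, hw, h⟩ := mem_fixed_sup_span_of_anisotropic (fischerForm _ K)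
    fischerForm_comm (fun _ => eq_zero_of_fischerForm_self_eq_zero)
    (fun M : G.group t K => (A.act (M : GL (Fin t) K)).toLinearMap)
    (fun M => (A.act (transposeGL (M : GL (Fin t) K))).toLinearMap)
    (fun M => fischerForm_act _) (homogeneousSubmodule _ K d)
    (fun M x => act_mem_homogeneousSubmodule _) (fun M x => act_mem_homogeneousSubmodule _)
    (homogeneousComponent_isHomogeneous d f)
  rw [h]
  -- The splitting yields invariance under the transposes, and every group element is one.
  refine Submodule.add_mem_sup (fun M hM => ?_) hw
  have := hu ⟨_, transposeGL_mem_group hSp hM⟩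
  rwa [transposeGL_transposeGL] at this

end Reynolds

end

noncomputable section

/-! ### The action over commutative rings and its base change. -/

section BaseChange

variable {t : ℕ} {A : ClassicalAction}

/-- The substitution attached to an invertible matrix over a commutative ring. -/
def ringSubst {R : Type*} [CommRing R] (M : GL (Fin t) R) :
    ClassicalAction.Vars t A → MvPolynomial (ClassicalAction.Vars t A) R
  | .y i j => ∑ l : Fin t, C (M.val i l) * X (.y l j)
  | .x i j => ∑ l : Fin t, X (.x i l) * C ((M⁻¹).val l j)
  | .y' i j => ∑ l : Fin t, C (M.val i l) * X (.y' l j)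

lemma act_eq_aeval_ringSubst {K : Type*} [Field K] (M : GL (Fin t) K) :
    A.act M = aeval (ringSubst M) := by
  refine MvPolynomial.algHom_ext fun u => ?_
  rw [ClassicalAction.act, aeval_X, aeval_X]
  cases u <;> rfl

lemma map_aeval_ringSubst {R S : Type*} [CommRing R] [CommRing S] (φ : R →+* S)
    (M : GL (Fin t) R) (f : MvPolynomial (ClassicalAction.Vars t A) R) :
    MvPolynomial.map φ (aeval (ringSubst M) f) =
      aeval (ringSubst (Matrix.GeneralLinearGroup.map φ M)) (MvPolynomial.map φ f) := by
  have h (u : ClassicalAction.Vars t A) :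
      MvPolynomial.map φ (ringSubst M u) = ringSubst (Matrix.GeneralLinearGroup.map φ M) u := by
    cases u <;> simp only [ringSubst, map_sum, map_mul, map_C, map_X] <;> rfl
  induction f using MvPolynomial.induction_on with
  | C r => simp
  | add p q hp hq => simp only [map_add, hp, hq]
  | mul_X p v hp => simp only [map_mul, aeval_X, hp, h, map_X]

/-- The difference `P f - f` for a polynomial `f` with rational coefficients. -/
def substDifference {R : Type*} [CommRing R] [Algebra ℚ R] (P : GL (Fin t) R)
    (f : MvPolynomial (ClassicalAction.Vars t A) ℚ) :
    MvPolynomial (ClassicalAction.Vars t A) R :=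
  aeval (ringSubst P) (MvPolynomial.map (algebraMap ℚ R) f) - MvPolynomial.map (algebraMap ℚ R) f

lemma map_substDifference {R S : Type*} [CommRing R] [Algebra ℚ R] [CommRing S] (φ : R →+* S)
    (c : ℚ →+* S) (P : GL (Fin t) R) (f : MvPolynomial (ClassicalAction.Vars t A) ℚ) :
    MvPolynomial.map φ (substDifference P f) =
      aeval (ringSubst (Matrix.GeneralLinearGroup.map φ P)) (MvPolynomial.map c f) -
        MvPolynomial.map c f := by
  simp only [substDifference, map_sub, map_aeval_ringSubst, MvPolynomial.map_map]
  rw [Subsingleton.elim (φ.comp (algebraMap ℚ R)) c]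

/-- The order reverses: after `Y ↦ M Y` the scalars in `M` stay put and `N` acts on `Y`, giving `M N
Y`. -/
lemma act_mul {K : Type*} [Field K] (M N : GL (Fin t) K)
    (f : MvPolynomial (ClassicalAction.Vars t A) K) :
    A.act (M * N) f = A.act N (A.act M f) := by
  suffices A.act (M * N) = (A.act N).comp (A.act M) from DFunLike.congr_fun this f
  refine MvPolynomial.algHom_ext fun u => ?_
  simp only [ClassicalAction.act, AlgHom.comp_apply, aeval_X]
  cases u <;>
  simp only [ClassicalAction.subst, map_sum, map_mul, aeval_X, aeval_C, algebraMap_eq, _root_.mul_inv_rev,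
    Units.val_mul, Matrix.mul_apply, Finset.sum_mul, Finset.mul_sum] <;>
  rw [Finset.sum_comm] <;>
  exact Finset.sum_congr rfl fun _ _ => Finset.sum_congr rfl fun _ _ => by ring

end BaseChange

/-! ### Specialising rational families; `GL` and `SL`. -/

section Density

variable {k : Type*} [Field k] {τ : Type*}

/-- An element of a localization `ℚ[τ][1/d]` vanishing at all rational points vanishes at
all points over fields of characteristic zero. -/
lemma map_eq_zero_of_forall_rat {d : MvPolynomial τ ℚ} (x : Localization.Away d)
    (hx : ∀ φ : Localization.Away d →+* ℚ, φ x = 0) (ψ : Localization.Away d →+* k) :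
    ψ x = 0 := by
  obtain ⟨n, a, ha⟩ := IsLocalization.Away.surj d x
  have hd : ψ (algebraMap _ _ d) ≠ 0 := ((IsLocalization.Away.algebraMap_isUnit d).map ψ).ne_zero
  -- The factor `d` covers the rational points outside the localization; a polynomial vanishing on
  -- all of `ℚ^τ` is zero.
  have had : a * d = 0 := by
    refine MvPolynomial.funext fun p => ?_
    rw [map_mul, map_zero]
    by_cases hp : eval p d = 0
    · rw [hp, mul_zero]
    · let φ : Localization.Away d →+* ℚ :=
        IsLocalization.Away.lift d (g := eval p) (isUnit_iff_ne_zero.2 hp)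
      have h1 : φ (algebraMap _ _ a) = eval p a := IsLocalization.Away.lift_eq _ _ _
      rw [← h1, ← ha, map_mul, hx, zero_mul, zero_mul]
  have h2 : ψ (algebraMap _ _ a) = 0 := by
    have := congrArg (fun z => ψ (algebraMap _ (Localization.Away d) z)) had
    simp only [map_mul, map_zero, mul_eq_zero] at this
    exact this.resolve_right hd
  rw [← ha, map_mul, mul_eq_zero, map_pow] at h2
  exact h2.resolve_right (pow_ne_zero _ hd)

variable [CharZero k] {t : ℕ} {A : ClassicalAction}

/-- A polynomial fixed by the rational points of a rational family of matrices is fixed by all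
its points over fields of characteristic zero. -/
lemma act_map_eq_of_rational_family {H : Set (GL (Fin t) ℚ)} {d : MvPolynomial τ ℚ}
    (P : GL (Fin t) (Localization.Away d))
    (hP : ∀ φ : Localization.Away d →+* ℚ, Matrix.GeneralLinearGroup.map φ P ∈ H)
    {f : MvPolynomial (ClassicalAction.Vars t A) ℚ} (hf : ∀ M ∈ H, A.act M f = f)
    {p : τ → k} (hp : eval₂ (Rat.castHom k) p d ≠ 0) (M : GL (Fin t) k)
    (hM : ∀ ψ : Localization.Away d →+* k,
      (∀ a, ψ (algebraMap _ _ a) = eval₂ (Rat.castHom k) p a) →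
        Matrix.GeneralLinearGroup.map ψ P = M) :
    A.act M (map (Rat.castHom k) f) = map (Rat.castHom k) f := by
  let ψ : Localization.Away d →+* k :=
    IsLocalization.Away.lift d (g := eval₂Hom (Rat.castHom k) p) (isUnit_iff_ne_zero.2 hp)
  have hψ := hM ψ fun a => IsLocalization.Away.lift_eq _ _ _
  -- The coefficients of `P f - f` vanish at all rational points of the family, hence at `ψ`.
  let F : MvPolynomial (ClassicalAction.Vars t A) (Localization.Away d) :=
    substDifference P f
  have h1 : MvPolynomial.map ψ F = 0 := by
    ext e
    rw [coeff_map, coeff_zero]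
    refine map_eq_zero_of_forall_rat _ (fun φ => ?_) ψ
    rw [← coeff_map, map_substDifference φ (RingHom.id ℚ), MvPolynomial.map_id, ← act_eq_aeval_ringSubst, hf _ (hP φ), sub_self,
      coeff_zero]
  rw [map_substDifference ψ (Rat.castHom k), hψ, ← act_eq_aeval_ringSubst] at h1
  exact sub_eq_zero.1 h1

lemma act_map_eq_of_generalLinear {f : MvPolynomial (ClassicalAction.Vars t A) ℚ}
    (hf : ∀ M, A.act M f = f) (M : GL (Fin t) k) :
    A.act M (map (Rat.castHom k) f) = map (Rat.castHom k) f := by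
  let d := (mvPolynomialX (Fin t) (Fin t) ℚ).det
  let Y : Matrix (Fin t) (Fin t) (Localization.Away d) :=
    (algebraMap _ (Localization.Away d)).mapMatrix (mvPolynomialX (Fin t) (Fin t) ℚ)
  have hY : IsUnit Y := by
    rw [Matrix.isUnit_iff_isUnit_det, ← RingHom.map_det]
    exact IsLocalization.Away.algebraMap_isUnit d
  refine act_map_eq_of_rational_family (H := Set.univ) (d := d) hY.unit (fun _ => Set.mem_univ _)
    (fun M _ => hf M) (p := fun ij => M.val ij.1 ij.2) ?_ M fun ψ hψ => ?_
  · change eval₂Hom _ _ d ≠ 0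
    rw [RingHom.map_det, RingHom.mapMatrix_apply, coe_eval₂Hom, mvPolynomialX_map_eval₂]
    exact ((Matrix.isUnit_iff_isUnit_det _).1 M.isUnit).ne_zero
  · ext i j
    change ψ (algebraMap (MvPolynomial (Fin t × Fin t) ℚ) _ _) = _
    rw [hψ, mvPolynomialX_apply, eval₂_X]

lemma act_map_eq_of_specialLinear (ht : 1 ≤ t) {f : MvPolynomial (ClassicalAction.Vars t A) ℚ}
    (hf : ∀ M : GL (Fin t) ℚ, M.val.det = 1 → A.act M f = f) (M : GL (Fin t) k)
    (hM : M.val.det = 1) :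
    A.act M (map (Rat.castHom k) f) = map (Rat.castHom k) f := by
  let d := (mvPolynomialX (Fin t) (Fin t) ℚ).det
  let Y : Matrix (Fin t) (Fin t) (Localization.Away d) :=
    (algebraMap _ (Localization.Away d)).mapMatrix (mvPolynomialX (Fin t) (Fin t) ℚ)
  -- Dividing the first row of the generic matrix by its determinant gives determinant one. At a
  -- point `M` of determinant one this changes nothing, so `M` belongs to the family.
  let D : Matrix (Fin t) (Fin t) (Localization.Away d) :=
    Matrix.diagonal (Function.update 1 ⟨0, ht⟩ (IsLocalization.Away.invSelf d))
  have hdet : (D * Y).det = 1 := by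
    rw [Matrix.det_mul, ← RingHom.map_det, Matrix.det_diagonal,
      Finset.prod_update_of_mem (Finset.mem_univ _)]
    simp only [Pi.one_apply, Finset.prod_const_one, mul_one]
    rw [mul_comm]
    exact IsLocalization.Away.mul_invSelf d
  have hY : IsUnit (D * Y) := by
    rw [Matrix.isUnit_iff_isUnit_det, hdet]
    exact isUnit_one
  have hdM : eval₂ (Rat.castHom k) (fun ij : Fin t × Fin t => M.val ij.1 ij.2) d = 1 := by
    change eval₂Hom _ _ d = 1
    rw [RingHom.map_det, RingHom.mapMatrix_apply, coe_eval₂Hom, mvPolynomialX_map_eval₂, hM]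
  refine act_map_eq_of_rational_family (H := {M | M.val.det = 1}) (d := d) hY.unit (fun φ => ?_)
    hf (p := fun ij => M.val ij.1 ij.2) (hdM ▸ one_ne_zero) M fun ψ hψ => ?_
  · change (φ.mapMatrix (D * Y)).det = 1
    rw [← RingHom.map_det, hdet, map_one]
  · have h1 : ψ (IsLocalization.Away.invSelf d) = 1 := by
      have := congrArg ψ (IsLocalization.Away.mul_invSelf (S := Localization.Away d) d)
      rwa [map_mul, hψ, hdM, one_mul, map_one] at this
    have h2 : ψ.mapMatrix D = 1 := by
      rw [RingHom.mapMatrix_apply, Matrix.diagonal_map (map_zero ψ), ← Matrix.diagonal_one]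
      congr 1
      ext i
      by_cases hi : i = ⟨0, ht⟩
      · subst hi; simp [h1]
      · simp [hi]
    refine Units.ext ?_
    change ψ.mapMatrix (D * Y) = _
    rw [map_mul, h2, one_mul]
    ext i j
    change ψ (algebraMap (MvPolynomial (Fin t × Fin t) ℚ) _ _) = _
    rw [hψ, mvPolynomialX_apply, eval₂_X]

end Density

/-! ### The Cayley parametrization of isometry groups. -/

section Cayley

variable {t : ℕ} {A : ClassicalAction} {k : Type*} [Field k] [CharZero k]

lemma mul_inv_mem_isometryGroup {K : Type*} [Field K] {B : Matrix (Fin t) (Fin t) K}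
    {U V : GL (Fin t) K} (h : V.valᵀ * B * V.val = U.valᵀ * B * U.val) :
    V * U⁻¹ ∈ isometryGroup B := by
  have h1 : U.val * (U⁻¹).val = 1 := U.mul_inv
  have h2 : (U⁻¹).valᵀ * U.valᵀ = 1 := by rw [← Matrix.transpose_mul, h1, Matrix.transpose_one]
  rw [mem_isometryGroup, Units.val_mul, Matrix.transpose_mul]
  calc (U⁻¹).valᵀ * V.valᵀ * B * (V.val * (U⁻¹).val)
      = (U⁻¹).valᵀ * (V.valᵀ * B * V.val) * (U⁻¹).val := by simp only [Matrix.mul_assoc]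
    _ = ((U⁻¹).valᵀ * U.valᵀ) * B * (U.val * (U⁻¹).val) := by
        rw [h]; simp only [Matrix.mul_assoc]
    _ = B := by rw [h1, h2, Matrix.one_mul, Matrix.mul_one]

/-- For `B² = e`, `Bᵀ = e B` and `e² = 1`, the matrices `B (P - e Pᵀ)` are infinitesimal
isometries of `B`. -/
def infinitesimalIsometry {R : Type*} [CommRing R] (B : Matrix (Fin t) (Fin t) ℤ) (e : ℤ)
    (P : Matrix (Fin t) (Fin t) R) : Matrix (Fin t) (Fin t) R :=
  (Int.castRingHom R).mapMatrix B * (P - e • Pᵀ)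

lemma mapMatrix_infinitesimalIsometry {R S : Type*} [CommRing R] [CommRing S] (φ : R →+* S)
    (B : Matrix (Fin t) (Fin t) ℤ) (e : ℤ) (P : Matrix (Fin t) (Fin t) R) :
    φ.mapMatrix (infinitesimalIsometry B e P) = infinitesimalIsometry B e (φ.mapMatrix P) := by
  have : φ.mapMatrix ((Int.castRingHom R).mapMatrix B) = (Int.castRingHom S).mapMatrix B := by
    ext; simp
  rw [infinitesimalIsometry, map_mul, map_sub, map_zsmul, this]
  rfl

lemma transpose_infinitesimalIsometry_mul {R : Type*} [CommRing R]
    {B : Matrix (Fin t) (Fin t) ℤ} {e : ℤ} (he : e * e = 1) (hT : Bᵀ = e • B) (hB : B * B = e • 1)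
    (P : Matrix (Fin t) (Fin t) R) :
    (infinitesimalIsometry B e P)ᵀ * (Int.castRingHom R).mapMatrix B =
      -((Int.castRingHom R).mapMatrix B * infinitesimalIsometry B e P) := by
  have hB' := congrArg (Int.castRingHom R).mapMatrix hB
  have hT' := congrArg (Int.castRingHom R).mapMatrix hT
  have hT'' : (Int.castRingHom R).mapMatrix Bᵀ = ((Int.castRingHom R).mapMatrix B)ᵀ := rfl
  rw [hT'', map_zsmul] at hT'
  rw [map_mul, map_zsmul, map_one] at hB'
  rw [infinitesimalIsometry, Matrix.transpose_mul, hT', ← Matrix.mul_assoc, hB', Matrix.mul_assoc,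
    smul_mul_assoc, hB', smul_smul, he, one_smul, Matrix.mul_one, smul_mul_assoc, Matrix.one_mul,
    Matrix.transpose_sub, Matrix.transpose_smul, Matrix.transpose_transpose, smul_sub, smul_smul,
    he, one_smul, neg_sub]

/-- If `1 + M` is invertible, then `M = (1 - Y)(1 + Y)⁻¹` with `Y = (1 - M)(1 + M)⁻¹` an
infinitesimal isometry. Such `Y` are the matrices `B (P - e Pᵀ)` with `P` unrestricted, so these `M`
form a rational family. -/
lemma act_map_eq_of_isUnit_one_add {B : Matrix (Fin t) (Fin t) ℤ} {e : ℤ} (he : e * e = 1)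
    (hT : Bᵀ = e • B) (hB : B * B = e • 1) {f : MvPolynomial (ClassicalAction.Vars t A) ℚ}
    (hf : ∀ M ∈ isometryGroup (B.map (Int.cast : ℤ → ℚ)), A.act M f = f) (M : GL (Fin t) k)
    (hM : M ∈ isometryGroup (B.map (Int.cast : ℤ → k))) (hM1 : IsUnit (1 + M.val)) :
    A.act M (map (Rat.castHom k) f) = map (Rat.castHom k) f := by
  let Z := infinitesimalIsometry B e (mvPolynomialX (Fin t) (Fin t) ℚ)
  -- The first factor makes the Cayley transform defined, the second makes it invertible.
  let d := (1 + Z).det * (1 - Z).det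
  let ι : MvPolynomial (Fin t × Fin t) ℚ →+* Localization.Away d := algebraMap _ _
  have hd : IsUnit (ι (1 + Z).det * ι (1 - Z).det) := by
    rw [← map_mul]; exact IsLocalization.Away.algebraMap_isUnit d
  have hU : IsUnit (ι.mapMatrix (1 + Z)) := by
    rw [Matrix.isUnit_iff_isUnit_det, ← RingHom.map_det]
    exact isUnit_of_mul_isUnit_left hd
  have hV : IsUnit (ι.mapMatrix (1 - Z)) := by
    rw [Matrix.isUnit_iff_isUnit_det, ← RingHom.map_det]
    exact isUnit_of_mul_isUnit_right hd
  have hmap (φ : Localization.Away d →+* ℚ) :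
      φ.mapMatrix (ι.mapMatrix Z) = infinitesimalIsometry B e
        (φ.mapMatrix (ι.mapMatrix (mvPolynomialX (Fin t) (Fin t) ℚ))) := by
    rw [mapMatrix_infinitesimalIsometry, mapMatrix_infinitesimalIsometry]
  obtain ⟨U, hUM⟩ := hM1
  let B' := (Int.castRingHom k).mapMatrix B
  let Y : Matrix (Fin t) (Fin t) k := (1 - M.val) * (U⁻¹).val
  have hYU : Y * U.val = 1 - M.val := by
    rw [Matrix.mul_assoc, ← Units.val_mul, inv_mul_cancel, Units.val_one, Matrix.mul_one]
  clear_value Y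
  have hYB : Yᵀ * B' = -(B' * Y) := by
    have hMB : M.valᵀ * B' * M.val = B' := hM
    have hUt : IsUnit U.valᵀ := by
      rw [Matrix.isUnit_transpose]; exact U.isUnit
    rw [eq_neg_iff_add_eq_zero]
    refine U.isUnit.mul_right_cancel (hUt.mul_left_cancel ?_)
    calc U.valᵀ * ((Yᵀ * B' + B' * Y) * U.val)
        = (Y * U.val)ᵀ * B' * U.val + U.valᵀ * B' * (Y * U.val) := by
          rw [Matrix.transpose_mul Y]; noncomm_ring
      _ = B' + B' - (M.valᵀ * B' * M.val + M.valᵀ * B' * M.val) := by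
          rw [hYU, hUM]
          simp only [Matrix.transpose_sub, Matrix.transpose_add, Matrix.transpose_one]
          noncomm_ring
      _ = U.valᵀ * (0 * U.val) := by rw [hMB, sub_self, zero_mul, mul_zero]
  have hYP : ∃ P, infinitesimalIsometry B e P = Y := by
    have hTB : B'ᵀ = (e : k) • B' := by
      rw [Int.cast_smul_eq_zsmul, ← map_zsmul, ← hT]; rfl
    have hBB : B' * B' = (e : k) • 1 := by
      rw [← map_mul, hB, map_zsmul, map_one, Int.cast_smul_eq_zsmul]
    have hek : (e : k) * e = 1 := by exact_mod_cast he
    -- As `(B Y)ᵀ = -e B Y`, this `P` satisfies `P - e Pᵀ = e B Y`, and `B (e B Y) = e² Y = Y`.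
    refine ⟨((e : k) / 2) • (B' * Y), ?_⟩
    have h1 : (((e : k) / 2) • (B' * Y))ᵀ = -((1 / 2 : k) • (B' * Y)) := by
      rw [Matrix.transpose_smul, Matrix.transpose_mul, hTB, mul_smul_comm, hYB, smul_smul,
        smul_neg, div_mul_eq_mul_div, hek]
    rw [infinitesimalIsometry, h1, ← Int.cast_smul_eq_zsmul k, smul_neg, sub_neg_eq_add, smul_smul,
      ← add_smul, mul_smul_comm]
    change _ • (B' * (B' * Y)) = Y
    rw [← Matrix.mul_assoc, hBB, smul_mul_assoc, Matrix.one_mul, smul_smul]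
    have : ((e : k) / 2 + e * (1 / 2)) * e = 1 := by linear_combination hek
    rw [this, one_smul]
  obtain ⟨P, hP⟩ := hYP
  have heval : (eval₂Hom (Rat.castHom k) fun ij : Fin t × Fin t => P ij.1 ij.2).mapMatrix Z = Y := by
    rw [mapMatrix_infinitesimalIsometry, ← hP]
    congr 1
    exact mvPolynomialX_map_eval₂ _ _
  -- With `U = 1 + M`: `(1 + Y) U = 2` and `(1 - Y) U = 2 M`, so `1 + Y` is invertible and `M` is
  -- recovered.
  have hYadd : (1 + Y) * U.val = (2 : k) • 1 := by
    rw [add_mul, hYU, hUM, one_mul, two_smul]; abel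
  have hYsub : (1 - Y) * U.val = M.val * ((1 + Y) * U.val) := by
    rw [hYadd, sub_mul, hYU, hUM, one_mul, mul_smul_comm, Matrix.mul_one, two_smul]; abel
  have hYsub' : 1 - Y = M.val * (1 + Y) := by
    rw [← Matrix.mul_assoc] at hYsub
    exact U.isUnit.mul_right_cancel hYsub
  have hdetadd : (1 + Y).det ≠ 0 := by
    intro h
    have := congrArg Matrix.det hYadd
    rw [Matrix.det_mul, h, zero_mul, Matrix.det_smul, Matrix.det_one, mul_one] at this
    exact pow_ne_zero _ two_ne_zero this.symm
  refine act_map_eq_of_rational_family (d := d) (hV.unit * hU.unit⁻¹) (fun φ => ?_) hf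
    (p := fun ij => P ij.1 ij.2) ?_ M fun ψ hψ => ?_
  · rw [map_mul, map_inv]
    refine mul_inv_mem_isometryGroup ?_
    change (φ.mapMatrix (ι.mapMatrix (1 - Z)))ᵀ * (Int.castRingHom ℚ).mapMatrix B *
      φ.mapMatrix (ι.mapMatrix (1 - Z)) =
      (φ.mapMatrix (ι.mapMatrix (1 + Z)))ᵀ * (Int.castRingHom ℚ).mapMatrix B *
      φ.mapMatrix (ι.mapMatrix (1 + Z))
    have key := transpose_infinitesimalIsometry_mul he hT hB
      (φ.mapMatrix (ι.mapMatrix (mvPolynomialX (Fin t) (Fin t) ℚ)))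
    simp only [map_sub, map_add, map_one, hmap φ]
    generalize infinitesimalIsometry B e (φ.mapMatrix (ι.mapMatrix (mvPolynomialX _ _ ℚ))) = W
      at key ⊢
    simp only [Matrix.transpose_sub, Matrix.transpose_add, Matrix.transpose_one, sub_mul, add_mul,
      one_mul, mul_sub, mul_add, mul_one, key]
    noncomm_ring
  · change eval₂Hom _ _ d ≠ 0
    rw [map_mul, RingHom.map_det, RingHom.map_det, map_add, map_sub, map_one, heval, hYsub',
      Matrix.det_mul]
    exact mul_ne_zero hdetadd (mul_ne_zero
      ((Matrix.isUnit_iff_isUnit_det _).1 M.isUnit).ne_zero hdetadd)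
  · have hψZ (W : Matrix (Fin t) (Fin t) (MvPolynomial (Fin t × Fin t) ℚ)) :
        ψ.mapMatrix (ι.mapMatrix W) =
          (eval₂Hom (Rat.castHom k) fun ij : Fin t × Fin t => P ij.1 ij.2).mapMatrix W := by
      ext i j
      exact hψ _
    rw [map_mul, map_inv, mul_inv_eq_iff_eq_mul]
    refine Units.ext ?_
    change ψ.mapMatrix (ι.mapMatrix (1 - Z)) = M.val * ψ.mapMatrix (ι.mapMatrix (1 + Z))
    rw [hψZ, hψZ, map_add, map_sub, map_one, heval, hYsub']

end Cayley

end

noncomputable section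

/-! ### Invertible translates by block diagonal matrices. -/

section BlockTranslates

variable {k : Type*} [Field k] {β : Type*} [Fintype β] [DecidableEq β]

/-- If every `β × β` matrix over `k` has an invertible translate by an integral matrix satisfying
`p`, then every matrix of blocks of that size has an invertible translate by a block diagonal
matrix with blocks satisfying `p`. -/
lemma exists_det_blockDiagonal_add_ne_zero (p : Matrix β β ℤ → Prop)
    (hp : ∀ S : Matrix β β k, ∃ N, p N ∧ ((Int.castRingHom k).mapMatrix N + S).det ≠ 0) (n : ℕ)
    (M : Matrix (β × Fin n) (β × Fin n) k) :
    ∃ N : Fin n → Matrix β β ℤ, (∀ i, p (N i)) ∧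
      ((blockDiagonal N).map (Int.cast : ℤ → k) + M).det ≠ 0 := by
  induction n with
  | zero => exact ⟨fun i => i.elim0, fun i => i.elim0, by simp⟩
  | succ n ih =>
    let e : β ⊕ (β × Fin n) → β × Fin (n + 1) :=
      Sum.elim (fun b => (b, 0)) fun x => (x.1, x.2.succ)
    have he : Function.Bijective e := by
      constructor
      · rintro (b | ⟨b, i⟩) (c | ⟨c, j⟩) h <;> simp [e, Fin.succ_ne_zero, eq_comm] at h ⊢ <;>
          simp_all
      · rintro ⟨b, i⟩
        refine Fin.cases ⟨.inl b, rfl⟩ (fun j => ⟨.inr (b, j), rfl⟩) i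
    let E := Equiv.ofBijective e he
    obtain ⟨N, hN, hdet⟩ := ih (M.submatrix (e ∘ Sum.inr) (e ∘ Sum.inr))
    set D := (blockDiagonal N).map (Int.cast : ℤ → k) + M.submatrix (e ∘ Sum.inr) (e ∘ Sum.inr)
      with hD
    have : Invertible D := Matrix.invertibleOfIsUnitDet _ (isUnit_iff_ne_zero.2 hdet)
    let Bl := M.submatrix (e ∘ Sum.inl) (e ∘ Sum.inr)
    let Cl := M.submatrix (e ∘ Sum.inr) (e ∘ Sum.inl)
    -- The new block is chosen against the Schur complement of `D`, so the determinant factors as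
    -- `det D` times a nonzero factor.
    obtain ⟨N₀, hN₀, hdet₀⟩ := hp (M.submatrix (e ∘ Sum.inl) (e ∘ Sum.inl) - Bl * ⅟D * Cl)
    refine ⟨Fin.cons N₀ N, Fin.cases hN₀ hN, ?_⟩
    have key : (((blockDiagonal (Fin.cons N₀ N : Fin (n + 1) → Matrix β β ℤ)).map
        (Int.cast : ℤ → k) + M).submatrix E E) =
        fromBlocks ((Int.castRingHom k).mapMatrix N₀ + M.submatrix (e ∘ Sum.inl) (e ∘ Sum.inl))
          Bl Cl D := by
      ext (b | ⟨b, i⟩) (c | ⟨c, j⟩)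
      · simp [E, e, blockDiagonal_apply]
      · simp [E, e, blockDiagonal_apply, Bl, (Fin.succ_ne_zero _).symm]
      · simp [E, e, blockDiagonal_apply, Cl, Fin.succ_ne_zero]
      · simp [E, e, blockDiagonal_apply, hD]
    rw [← Matrix.det_submatrix_equiv_self E, key, Matrix.det_fromBlocks₂₂, add_sub_assoc]
    exact mul_ne_zero hdet hdet₀

/-- Translates by isometries of an integral form that is an orthogonal sum of copies of `J`. -/
lemma exists_isometry_det_add_ne_zero {t n : ℕ} (J : Matrix β β ℤ)
    (hJ : ∀ S : Matrix β β k, ∃ N, Nᵀ * J * N = J ∧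
      ((Int.castRingHom k).mapMatrix N + S).det ≠ 0)
    (E : β × Fin n ≃ Fin t) (B : Matrix (Fin t) (Fin t) ℤ)
    (hB : B.submatrix E E = blockDiagonal fun _ => J) (M : Matrix (Fin t) (Fin t) k) :
    ∃ N, Nᵀ * B * N = B ∧ (N.map (Int.cast : ℤ → k) + M).det ≠ 0 := by
  obtain ⟨N, hN, hdet⟩ := exists_det_blockDiagonal_add_ne_zero _ hJ n (M.submatrix E E)
  have hB' : B = (blockDiagonal fun _ => J).submatrix E.symm E.symm := by
    rw [← hB]; simp
  refine ⟨(blockDiagonal N).submatrix E.symm E.symm, ?_, ?_⟩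
  · rw [hB', Matrix.transpose_submatrix, Matrix.submatrix_mul_equiv, Matrix.submatrix_mul_equiv,
      blockDiagonal_transpose, ← blockDiagonal_mul, ← blockDiagonal_mul]
    simp only [hN]
  · rw [← Matrix.det_submatrix_equiv_self E]
    convert hdet using 2
    ext; simp

end BlockTranslates

/-! ### Density of the rational points for `O` and `Sp`. -/

section Density

variable {t : ℕ} {A : ClassicalAction} {k : Type*} [Field k] [CharZero k]

/-- The Cayley transform misses matrices with eigenvalue `-1`. An integral isometry `N` with `N + M`
invertible repairs this: `1 + N⁻¹ M = N⁻¹ (N + M)`, and `N`, being rational, fixes `f`. -/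
lemma act_map_eq_of_isometry {B : Matrix (Fin t) (Fin t) ℤ} {e : ℤ} (he : e * e = 1)
    (hT : Bᵀ = e • B) (hB : B * B = e • 1)
    (hN : ∀ M : Matrix (Fin t) (Fin t) k,
      ∃ N, Nᵀ * B * N = B ∧ (N.map (Int.cast : ℤ → k) + M).det ≠ 0)
    {f : MvPolynomial (ClassicalAction.Vars t A) ℚ}
    (hf : ∀ M ∈ isometryGroup (B.map (Int.cast : ℤ → ℚ)), A.act M f = f) (M : GL (Fin t) k)
    (hM : M ∈ isometryGroup (B.map (Int.cast : ℤ → k))) :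
    A.act M (MvPolynomial.map (Rat.castHom k) f) = MvPolynomial.map (Rat.castHom k) f := by
  obtain ⟨N, hNB, hdet⟩ := hN M.val
  have hNu : IsUnit N := by
    have h1 : (e • (B * Nᵀ * B)) * N = 1 := by
      rw [smul_mul_assoc, show B * Nᵀ * B * N = B * (Nᵀ * B * N) by simp only [Matrix.mul_assoc],
        hNB, hB, smul_smul, he, one_smul]
    exact IsUnit.of_mul_eq_one_right _ h1
  have hmem : Matrix.GeneralLinearGroup.map (Int.castRingHom ℚ) hNu.unit ∈
      isometryGroup (B.map (Int.cast : ℤ → ℚ)) := by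
    have := congrArg (Int.castRingHom ℚ).mapMatrix hNB
    rw [map_mul, map_mul] at this
    exact this
  let N' : GL (Fin t) k := Matrix.GeneralLinearGroup.map (Int.castRingHom k) hNu.unit
  have hN' : N' ∈ isometryGroup (B.map (Int.cast : ℤ → k)) := by
    have := congrArg (Int.castRingHom k).mapMatrix hNB
    rw [map_mul, map_mul] at this
    exact this
  have hNf : A.act N' (MvPolynomial.map (Rat.castHom k) f) =
      MvPolynomial.map (Rat.castHom k) f := by
    have h1 : N' = Matrix.GeneralLinearGroup.map (Rat.castHom k)
        (Matrix.GeneralLinearGroup.map (Int.castRingHom ℚ) hNu.unit) := by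
      ext i j
      change ((_ : ℤ) : k) = (((_ : ℤ) : ℚ) : k)
      rw [Rat.cast_intCast]
    rw [h1, act_eq_aeval_ringSubst, ← map_aeval_ringSubst, ← act_eq_aeval_ringSubst,
      hf _ hmem]
  have hsplit : M = N' * (N'⁻¹ * M) := by rw [mul_inv_cancel_left]
  rw [hsplit, act_mul, hNf]
  refine act_map_eq_of_isUnit_one_add he hT hB hf _ (mul_mem (inv_mem hN') hM) ?_
  have : (1 + (N'⁻¹ * M).val : Matrix (Fin t) (Fin t) k) = (N'⁻¹).val * (N'.val + M.val) := by
    rw [mul_add, ← Units.val_mul, inv_mul_cancel, Units.val_one, Units.val_mul]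
  rw [this]
  exact (N'⁻¹).isUnit.mul ((Matrix.isUnit_iff_isUnit_det _).2 (isUnit_iff_ne_zero.2 hdet))

/-- The numbers `s + 1` and `s - 1` cannot both vanish. In the orthogonal group these signs also
reach determinant `-1`, which Cayley transforms never have. -/
lemma exists_sign_det_add_ne_zero (S : Matrix (Fin 1) (Fin 1) k) :
    ∃ N : Matrix (Fin 1) (Fin 1) ℤ, Nᵀ * 1 * N = 1 ∧
      ((Int.castRingHom k).mapMatrix N + S).det ≠ 0 := by
  by_cases h : 1 + S 0 0 = 0
  · refine ⟨-1, by simp, ?_⟩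
    have h1 : S 0 0 = -1 := by linear_combination h
    simp only [map_neg, map_one, det_fin_one, Matrix.add_apply, Matrix.neg_apply, one_apply_eq, h1]
    norm_num
  · exact ⟨1, by simp, by simpa [det_fin_one] using h⟩

lemma exists_specialLinear_det_add_ne_zero (S : Matrix (Fin 2) (Fin 2) k) :
    ∃ N : Matrix (Fin 2) (Fin 2) ℤ, Nᵀ * !![0, 1; -1, 0] * N = !![0, 1; -1, 0] ∧
      ((Int.castRingHom k).mapMatrix N + S).det ≠ 0 := by
  by_contra! h
  -- If all five translates are singular, `±1` force trace `0` and determinant `-1`, the next two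
  -- force `c = 0` and then `b = 0`, and the last forces `a = 0`, so the determinant is `0`.
  have h1 := h !![1, 0; 0, 1] (by decide)
  have h2 := h !![-1, 0; 0, -1] (by decide)
  have h3 := h !![0, 1; -1, 0] (by decide)
  have h4 := h !![1, 1; 0, 1] (by decide)
  have h5 := h !![2, 1; 1, 1] (by decide)
  simp [det_fin_two] at h1 h2 h3 h4 h5
  set a := S 0 0
  set b := S 0 1
  set c := S 1 0
  set d := S 1 1
  have two : (2 : k) ≠ 0 := two_ne_zero
  have had : d = -a := mul_left_cancel₀ two (by linear_combination h1 - h2)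
  have hdet : a * d - b * c = -1 := mul_left_cancel₀ two (by linear_combination h1 + h2)
  have hc : c = 0 := by linear_combination h1 - h4
  have hb : b = 0 := by linear_combination h3 - hdet + hc
  rw [had, hb, hc] at hdet
  rw [had, hb, hc] at h5
  have ha : a = 0 := by linear_combination hdet - h5
  rw [ha] at hdet
  simp at hdet

lemma orthogonalGroup_eq (K : Type*) [Field K] :
    ClassicalFamily.O.group t K =
      isometryGroup ((1 : Matrix (Fin t) (Fin t) ℤ).map (Int.cast : ℤ → K)) := by
  rw [Matrix.map_one _ Int.cast_zero Int.cast_one]; rfl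

lemma symplecticGroup_eq (K : Type*) [Field K] :
    ClassicalFamily.Sp.group t K =
      isometryGroup ((intSymplecticForm t).map (Int.cast : ℤ → K)) := by
  rw [map_intSymplecticForm]; rfl

/-- The indices `j` and `j + s` pair into `s` orthogonal hyperbolic planes. -/
lemma intSymplecticForm_submatrix (s : ℕ) :
    (intSymplecticForm (2 * s)).submatrix finProdFinEquiv finProdFinEquiv =
      blockDiagonal fun _ : Fin s => !![0, 1; -1, 0] := by
  ext ⟨i, j⟩ ⟨i', j'⟩
  have hj := j.2
  have hj' := j'.2
  simp only [intSymplecticForm, Matrix.submatrix_apply, Matrix.of_apply, blockDiagonal_apply,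
    finProdFinEquiv_apply_val, Nat.mul_div_cancel_left s two_pos, Fin.ext_iff]
  fin_cases i <;> fin_cases i' <;> simp <;> split_ifs <;> omega

theorem ratIncl_mem_invariants {G : ClassicalFamily} (ht : 1 ≤ t)
    (hSp : G = ClassicalFamily.Sp → Even t) {f : MvPolynomial (ClassicalAction.Vars t A) ℚ}
    (hf : f ∈ invariants G A t ℚ) :
    ratIncl (ClassicalAction.Vars t A) k f ∈ invariants G A t k := by
  intro M hM
  rcases G with _ | _ | _ | _
  · exact act_map_eq_of_generalLinear (fun M => hf M (Subgroup.mem_top _)) M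
  · exact act_map_eq_of_specialLinear ht
      (fun M h => hf M (MonoidHom.mem_ker.2 (Units.ext h))) M
      (congrArg Units.val (MonoidHom.mem_ker.1 hM))
  · rw [orthogonalGroup_eq] at hM
    refine act_map_eq_of_isometry (e := 1) (by simp) (by simp) (by simp)
      (exists_isometry_det_add_ne_zero 1 exists_sign_det_add_ne_zero (Equiv.uniqueProd _ _) 1 ?_)
      (fun M h => hf M (by rwa [orthogonalGroup_eq])) M hM
    ext ⟨i, j⟩ ⟨i', j'⟩
    simp [Matrix.one_apply, blockDiagonal_apply, Subsingleton.elim i i']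
  · rw [symplecticGroup_eq] at hM
    have ht2 := hSp rfl
    refine act_map_eq_of_isometry (e := -1) (by simp) (intSymplecticForm_transpose t ht2)
      (intSymplecticForm_mul_self t ht2) ?_
      (fun M h => hf M (by rwa [symplecticGroup_eq])) M hM
    obtain ⟨s, rfl⟩ := even_iff_exists_two_mul.1 ht2
    exact exists_isometry_det_add_ne_zero _ exists_specialLinear_det_add_ne_zero finProdFinEquiv _
      (intSymplecticForm_submatrix s)

end Density

/-! ### Descent of the decomposition to `ℚ`. -/

section BaseField

variable {G : ClassicalFamily} {A : ClassicalAction} {t : ℕ} {k : Type*} [Field k] [CharZero k]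

lemma ratIncl_act (M : GL (Fin t) ℚ) (f : MvPolynomial (ClassicalAction.Vars t A) ℚ) :
    ratIncl _ k (A.act M f) =
      A.act (Matrix.GeneralLinearGroup.map (Rat.castHom k) M) (ratIncl _ k f) := by
  rw [act_eq_aeval_ringSubst, act_eq_aeval_ringSubst]
  exact map_aeval_ringSubst _ M f

lemma map_mem_group {M : GL (Fin t) ℚ} (hM : M ∈ G.group t ℚ) :
    Matrix.GeneralLinearGroup.map (Rat.castHom k) M ∈ G.group t k := by
  have hiso (B : Matrix (Fin t) (Fin t) ℤ) (h : M ∈ isometryGroup (B.map (Int.cast : ℤ → ℚ))) :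
      Matrix.GeneralLinearGroup.map (Rat.castHom k) M ∈
        isometryGroup (B.map (Int.cast : ℤ → k)) := by
    have h1 := congrArg (Rat.castHom k).mapMatrix (mem_isometryGroup.1 h)
    have h2 : (Rat.castHom k).mapMatrix (B.map (Int.cast : ℤ → ℚ)) =
        B.map (Int.cast : ℤ → k) := by
      ext; simp
    rw [map_mul, map_mul, h2] at h1
    exact h1
  rcases G with _ | _ | _ | _
  · exact Subgroup.mem_top _
  · have h : M.val.det = 1 := congrArg Units.val (MonoidHom.mem_ker.1 hM)
    refine MonoidHom.mem_ker.2 (Units.ext ?_)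
    change ((Rat.castHom k).mapMatrix M.val).det = 1
    rw [← RingHom.map_det, h, map_one]
  · rw [orthogonalGroup_eq] at hM ⊢
    exact hiso _ hM
  · rw [symplecticGroup_eq] at hM ⊢
    exact hiso _ hM

lemma ratIncl_smul (a : ℚ) (f : MvPolynomial (ClassicalAction.Vars t A) ℚ) :
    ratIncl _ k (a • f) = (a : k) • ratIncl _ k f := by
  rw [smul_eq_C_mul, smul_eq_C_mul, map_mul, ratIncl, MvPolynomial.map_C]
  rfl

lemma ratIncl_mem_actionDifferences {f : MvPolynomial (ClassicalAction.Vars t A) ℚ}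
    (hf : f ∈ actionDifferences G A t ℚ) :
    ratIncl _ k f ∈ actionDifferences G A t k := by
  induction hf using Submodule.span_induction with
  | mem x hx =>
    obtain ⟨M, f, rfl⟩ := hx
    rw [map_sub, ratIncl_act]
    exact Submodule.subset_span ⟨⟨_, map_mem_group M.2⟩, _, rfl⟩
  | zero => rw [map_zero]; exact zero_mem _
  | add x y _ _ hx hy => rw [map_add]; exact add_mem hx hy
  | smul a x _ hx => rw [ratIncl_smul]; exact Submodule.smul_mem _ _ hx

lemma exists_rat_decomposition (hSp : G = ClassicalFamily.Sp → Even t)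
    (f : MvPolynomial (ClassicalAction.Vars t A) ℚ) :
    ∃ u ∈ invariants G A t ℚ, ∃ w ∈ actionDifferences G A t ℚ, u + w = f :=
  Submodule.mem_sup.1
    ((invariants_sup_actionDifferences_of_linearOrder (K := ℚ) hSp).symm ▸ Submodule.mem_top)

/-- Monomials span over `k` and are rational, so their decompositions over `ℚ` suffice. -/
lemma invariants_sup_actionDifferences (ht : 1 ≤ t) (hSp : G = ClassicalFamily.Sp → Even t) :
    Subalgebra.toSubmodule (invariants G A t k) ⊔ actionDifferences G A t k = ⊤ := by
  rw [eq_top_iff, ← (basisMonomials _ k).span_eq, Submodule.span_le]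
  rintro _ ⟨d, rfl⟩
  obtain ⟨u, hu, w, hw, h⟩ := exists_rat_decomposition (G := G) hSp (monomial d (1 : ℚ))
  have h1 : basisMonomials _ k d = ratIncl _ k u + ratIncl _ k w := by
    rw [← map_add, h, ratIncl, map_monomial, map_one, coe_basisMonomials]
  rw [h1]
  exact Submodule.add_mem_sup (ratIncl_mem_invariants ht hSp hu) (ratIncl_mem_actionDifferences hw)

/-- One rational decomposition `u + w` serves both fields, and both operators return `u`. -/
lemma IsReynolds.apply_ratIncl (ht : 1 ≤ t) (hSp : G = ClassicalFamily.Sp → Even t)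
    {R : MvPolynomial (ClassicalAction.Vars t A) k →ₗ[k] invariants G A t k} (hR : IsReynolds R)
    {RQ : MvPolynomial (ClassicalAction.Vars t A) ℚ →ₗ[ℚ] invariants G A t ℚ}
    (hRQ : IsReynolds RQ) (f : MvPolynomial (ClassicalAction.Vars t A) ℚ) :
    (R (ratIncl _ k f) : MvPolynomial (ClassicalAction.Vars t A) k) =
      ratIncl _ k (RQ f : MvPolynomial (ClassicalAction.Vars t A) ℚ) := by
  obtain ⟨u, hu, w, hw, rfl⟩ := exists_rat_decomposition (G := G) hSp f
  rw [hRQ.apply_add hu hw, map_add, hR.apply_add (ratIncl_mem_invariants ht hSp hu)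
    (ratIncl_mem_actionDifferences hw)]

end BaseField

end

theorem proposition6p3 {k : Type*} [Field k] [CharZero k]
    (G : ClassicalFamily) (A : ClassicalAction) (t : ℕ) (ht : 1 ≤ t)
    (hSp : G = ClassicalFamily.Sp → Even t) :
    -- the Reynolds operators exist and are unique
    (∃! R : MvPolynomial (ClassicalAction.Vars t A) k →ₗ[k] invariants G A t k, IsReynolds R) ∧
    (∃! R : MvPolynomial (ClassicalAction.Vars t A) ℚ →ₗ[ℚ] invariants G A t ℚ, IsReynolds R) ∧
    (∃! R : MvPolynomial (ClassicalAction.Vars t A) ℂ →ₗ[ℂ] invariants G A t ℂ, IsReynolds R) ∧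
    -- the right-hand vertical arrow of the diagram
    (∀ f ∈ invariants G A t ℚ, ratIncl (ClassicalAction.Vars t A) k f ∈ invariants G A t k) ∧
    ∀ (Rk : MvPolynomial (ClassicalAction.Vars t A) k →ₗ[k] invariants G A t k)
      (RQ : MvPolynomial (ClassicalAction.Vars t A) ℚ →ₗ[ℚ] invariants G A t ℚ)
      (RC : MvPolynomial (ClassicalAction.Vars t A) ℂ →ₗ[ℂ] invariants G A t ℂ),
      IsReynolds Rk → IsReynolds RQ → IsReynolds RC →
      -- the diagram commutes
      (∀ f : MvPolynomial (ClassicalAction.Vars t A) ℚ,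
        (Rk (ratIncl (ClassicalAction.Vars t A) k f) : MvPolynomial (ClassicalAction.Vars t A) k) =
          ratIncl (ClassicalAction.Vars t A) k (RQ f : MvPolynomial (ClassicalAction.Vars t A) ℚ)) ∧
      -- on a monomial, both operators give the same polynomial with rational coefficients
      (∀ d : ClassicalAction.Vars t A →₀ ℕ, ∃ q : MvPolynomial (ClassicalAction.Vars t A) ℚ,
        (Rk (monomial d 1) : MvPolynomial (ClassicalAction.Vars t A) k) = ratIncl (ClassicalAction.Vars t A) k q ∧
        (RC (monomial d 1) : MvPolynomial (ClassicalAction.Vars t A) ℂ) = ratIncl (ClassicalAction.Vars t A) ℂ q) := by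
  refine ⟨existsUnique_isReynolds hSp (invariants_sup_actionDifferences ht hSp),
    existsUnique_isReynolds hSp (invariants_sup_actionDifferences ht hSp),
    existsUnique_isReynolds hSp (invariants_sup_actionDifferences ht hSp),
    fun f hf => ratIncl_mem_invariants ht hSp hf, fun Rk RQ RC hk hQ hC =>
    ⟨hk.apply_ratIncl ht hSp hQ, fun d => ⟨RQ (monomial d 1), ?_, ?_⟩⟩⟩
  · rw [← hk.apply_ratIncl ht hSp hQ, ratIncl, map_monomial, map_one (Rat.castHom k)]
  · rw [← hC.apply_ratIncl ht hSp hQ, ratIncl, map_monomial, map_one (Rat.castHom ℂ)]
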